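/- A pseudo-random generator (PRG) is a family of functions $G=\{G_n:\{0,1\}^n\times\mathbb{N}\to\{0,1\}\}_{n\in\mathbb{N}}$, where $G_n(s,i)$ is the $i$-th bit generated from the $n$-bit seed $s$ (no computational assumption on $G$ is needed). For a uniformly distributed seed $s\in\{0,1\}^n$, write $X_i=G_n(s,i)$, and let $\mathbf p_{n,i,k}$ be the probability distribution on $\{0,1\}^k$ of the block $(X_{i+1},\dots,X_{i+k})$. The bias of a probability distribution $\mathbf p$ on $\{0,1\}^k$ is $B(\mathbf p)=\frac12\sum_{j\in\{0,1\}^k}|p_j-2^{-k}|$. Let $|\phi_0(0)\rangle=|0\rangle$, $|\phi_0(1)\rangle=|1\rangle$, $|\phi_1(0)\rangle=|+\rangle=\frac1{\sqrt2}(|0\rangle+|1\rangle)$, $|\phi_1(1)\rangle=|-\rangle=\frac1{\sqrt2}(|0\rangle-|1\rangle)$. For $Y\in\{0,1\}^k$ and $j\in\{0,1\}^k$ put $|\phi_j\rangle=\bigotimes_{m=1}^k|\phi_{j_m}(Y_m)\rangle$, and for a probability distribution $\mathbf p$ on $\{0,1\}^k$ let $$\rho_{Y}(\mathbf p)=\sum_{j\in\{0,1\}^k}p_j\,|\phi_j\rangle\langle\phi_j|,\qquad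 \sigma_{Y}=\sum_{j\in\{0,1\}^k}2^{-k}\,|\phi_j\rangle\langle\phi_j| .$$ Let $S(\rho)=-\mathrm{tr}(\rho\log_2\rho)$ denote the von Neumann entropy. **Corollary.** Let $G$ be a PRG, and let $f:\mathbb{N}\times\mathbb{N}\to(0,\infty)$ and $g:\mathbb{N}\to\{1,2,\dots\}$ satisfy $\lim_{n\to\infty}g(n)=+\infty$ and $\lim_{n\to\infty}g(n)\,f(g(n),n)=0$. For each $n$ let $i(n)\in\mathbb{N}$ be a starting position, and suppose that $B(\mathbf p_{n,i(n),k})\le f(k,n)$ for all $n$ and all $1\le k\le g(n)$. Then, for every choice of bit strings $Y^{g(n)}\in\{0,1\}^{g(n)}$, $n\in\mathbb{N}$, $$\lim_{n\to\infty}\left|S\big(\rho_{Y^{g(n)}}(\mathbf p_{n,i(n),g(n)})\big)-S\big(\sigma_{Y^{g(n)}}\big)\right|=0 .$$ -/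

import Mathlib

open Filter Topology
open scoped ComplexOrder

noncomputable section

/-- A density matrix on the finite-dimensional Hilbert space with orthonormal basis `ι`. -/
structure DensityMatrix (ι : Type) [Fintype ι] [DecidableEq ι] where
  mat : Matrix ι ι ℂ
  posSemidef : mat.PosSemidef
  trace_eq_one : mat.trace = 1

/-- The von Neumann entropy (in bits): the Shannon entropy `-∑ λ log₂ λ` of the spectrum. -/
def vonNeumannEntropy {ι : Type} [Fintype ι] [DecidableEq ι] (ρ : DensityMatrix ι) : ℝ :=
  -∑ i, ρ.posSemidef.isHermitian.eigenvalues i *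
    Real.logb 2 (ρ.posSemidef.isHermitian.eigenvalues i)

/-- The qubit encoding the bit `y` in the basis selected by `x`:
`|0⟩, |1⟩` for `x = 0` and `|+⟩, |-⟩` for `x = 1`. -/
def codeQubit (x y : Fin 2) : Fin 2 → ℂ :=
  if x = 0 then
    (if y = 0 then ![1, 0] else ![0, 1])
  else
    (if y = 0 then ![((1 / √2 : ℝ) : ℂ), ((1 / √2 : ℝ) : ℂ)]
      else ![((1 / √2 : ℝ) : ℂ), -((1 / √2 : ℝ) : ℂ)])

/-- The product vector `⨂ᵢ |φ_{xᵢ}(yᵢ)⟩` of `k` qubits, in coordinates with respect to the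
computational basis, which is indexed by the bit strings of length `k`. -/
def codeVector {k : ℕ} (x y : Fin k → Fin 2) : (Fin k → Fin 2) → ℂ :=
  fun z => ∏ i, codeQubit (x i) (y i) (z i)

/-- The projector `|φ⟩⟨φ|` onto the product vector. -/
def codeProjector {k : ℕ} (x y : Fin k → Fin 2) : Matrix (Fin k → Fin 2) (Fin k → Fin 2) ℂ :=
  Matrix.vecMulVec (codeVector x y) (star (codeVector x y))

theorem codeQubit_norm (x y : Fin 2) :
    ∑ z, codeQubit x y z * star (codeQubit x y z) = 1 := by
  have h : ((√2 : ℝ) : ℂ)⁻¹ * ((√2 : ℝ) : ℂ)⁻¹ = 1 / 2 := by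
    rw [← mul_inv, ← Complex.ofReal_mul, Real.mul_self_sqrt (by norm_num)]
    norm_num
  fin_cases x <;> fin_cases y <;> simp [codeQubit, Fin.sum_univ_two, h] <;> norm_num

theorem codeProjector_trace {k : ℕ} (x y : Fin k → Fin 2) : (codeProjector x y).trace = 1 := by
  have h : (codeProjector x y).trace =
      ∑ z : Fin k → Fin 2, ∏ i, (codeQubit (x i) (y i) (z i) *
        star (codeQubit (x i) (y i) (z i))) := by
    simp [codeProjector, codeVector, Matrix.trace, Matrix.vecMulVec_apply, Finset.prod_mul_distrib]
  have h2 := Finset.prod_univ_sum (fun _ : Fin k => (Finset.univ : Finset (Fin 2)))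
    (fun i z => codeQubit (x i) (y i) z * star (codeQubit (x i) (y i) z))
  rw [Fintype.piFinset_univ] at h2
  rw [h, ← h2]
  exact Finset.prod_eq_one fun i _ => codeQubit_norm (x i) (y i)

theorem pmf_sum_toReal {α : Type} [Fintype α] (p : PMF α) : ∑ a, (p a).toReal = 1 := by
  have h : ∑ a, p a = 1 := by
    rw [← tsum_fintype (L := SummationFilter.unconditional α)]
    exact p.tsum_coe
  rw [← ENNReal.toReal_sum fun a _ => p.apply_ne_top a, h, ENNReal.toReal_one]

/-- The state `∑_j p_j |φ_j⟩⟨φ_j|` of the `k` qubits encoding the bits `y`, when the block of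
basis-selecting bits has the distribution `p`. -/
def encodedState {k : ℕ} (y : Fin k → Fin 2) (p : PMF (Fin k → Fin 2)) :
    DensityMatrix (Fin k → Fin 2) where
  mat := ∑ j, (((p j).toReal : ℝ) : ℂ) • codeProjector j y
  posSemidef := by
    refine Matrix.posSemidef_sum _ fun j _ => ?_
    refine Matrix.PosSemidef.smul (Matrix.posSemidef_vecMulVec_self_star _) ?_
    exact_mod_cast ENNReal.toReal_nonneg
  trace_eq_one := by
    simp only [Matrix.trace_sum, Matrix.trace_smul, codeProjector_trace, smul_eq_mul, mul_one]
    exact_mod_cast pmf_sum_toReal p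

/-- The state of the `k` qubits encoding `y` when the basis-selecting bits are fair and
independent. -/
def fairState {k : ℕ} (y : Fin k → Fin 2) : DensityMatrix (Fin k → Fin 2) :=
  encodedState y (PMF.uniformOfFintype (Fin k → Fin 2))

/-- The trace distance `½ ∑ |a_j - b_j|` between probability vectors. -/
def traceDistance {α : Type} [Fintype α] (a b : PMF α) : ℝ :=
  (1 / 2) * ∑ j, |(a j).toReal - (b j).toReal|

/-- The bias of a distribution: its trace distance to the uniform distribution. -/
def bias {α : Type} [Fintype α] [Nonempty α] (p : PMF α) : ℝ :=
  traceDistance p (PMF.uniformOfFintype α)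

/-- A family of bit generators: `G n s i` is the `i`-th bit generated from the `n`-bit seed `s`. -/
abbrev BitGenerator : Type := (n : ℕ) → (Fin n → Fin 2) → ℕ → Fin 2

/-- The distribution of the block `X_{i+1}, …, X_{i+k}` generated from a uniformly distributed
`n`-bit seed. -/
def blockLaw (G : BitGenerator) (n i k : ℕ) : PMF (Fin k → Fin 2) :=
  (PMF.uniformOfFintype (Fin n → Fin 2)).map fun s m => G n s (i + 1 + m)

end

/-! The entropy difference obeys a Fannes-type bound whose only growing factor is the number of
qubits times the bias, which tends to 0 here. Put δ = `traceDistance p q`. The positive and negative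
parts of p - q, each of mass δ, give positive matrices A, B of trace δ with ρ(p) + A = ρ(q) + B. In
natural logarithms and without normalising traces, S(ρ(p)) ≤ S(ρ(p) + A) + 2δ (`le_add_posSemidef`),
and S(ρ(q) + B) exceeds S(ρ(q)) by at most the Shannon entropy of the weights of B
(`add_ensemble_le`), hence by at most -δ log δ + δ k log 2. Exchanging p and q bounds the absolute
value. Both matrix inequalities rest on `le_sum_diag`. -/

/-- The sum of `-λ log λ` over the spectrum (with multiplicity) of a complex matrix. -/
noncomputable def spectralEntropy {ι : Type*} [Fintype ι] [DecidableEq ι] (M : Matrix ι ι ℂ) : ℝ :=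
  (M.charpoly.roots.map fun z => Real.negMulLog z.re).sum

/-! ### Entropy inequalities for positive matrices and weights -/

namespace spectralEntropy

open Matrix

variable {ι κ : Type*} [Fintype ι] [DecidableEq ι] [Fintype κ] [DecidableEq κ]

theorem eq_sum_eigenvalues {M : Matrix ι ι ℂ} (hM : M.IsHermitian) :
    spectralEntropy M = ∑ i, Real.negMulLog (hM.eigenvalues i) := by
  rw [spectralEntropy, hM.roots_charpoly_eq_eigenvalues, Multiset.map_map]
  rfl

/-- The two products share their nonzero eigenvalues with multiplicity; surplus zeros contribute
nothing because `negMulLog 0 = 0`. -/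
theorem mul_comm (A : Matrix ι κ ℂ) (B : Matrix κ ι ℂ) :
    spectralEntropy (A * B) = spectralEntropy (B * A) := by
  have h := congrArg (fun q : Polynomial ℂ => (q.roots.map fun z => Real.negMulLog z.re).sum)
    (Matrix.charpoly_mul_comm' A B)
  have hne (d : ℕ) {q : Polynomial ℂ} (hq : q.Monic) : Polynomial.X ^ d * q ≠ 0 :=
    ((Polynomial.monic_X_pow d).mul hq).ne_zero
  simpa [spectralEntropy, Multiset.sum_nsmul, Polynomial.roots_mul (hne _ (Matrix.charpoly_monic _)), Polynomial.roots_X_pow,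
    Multiset.map_nsmul] using h

theorem unitary_conj (M : Matrix ι ι ℂ) (U : Matrix.unitaryGroup ι ℂ) :
    spectralEntropy (U.1ᴴ * M * U.1) = spectralEntropy M := by
  rw [spectralEntropy.mul_comm, ← Matrix.mul_assoc, ← star_eq_conjTranspose,
    Matrix.mem_unitaryGroup_iff.1 U.2, Matrix.one_mul]

theorem apply_eq_sum_eigenvalues {M : Matrix ι ι ℂ} (hM : M.IsHermitian) (z w : ι) :
    M z w = ∑ i, hM.eigenvectorUnitary.1 z i * hM.eigenvalues i *
      star (hM.eigenvectorUnitary.1 w i) := by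
  conv_lhs => rw [hM.spectral_theorem, Unitary.conjStarAlgAut_apply, Matrix.mul_apply]
  refine Finset.sum_congr rfl fun i _ => ?_
  rw [Matrix.mul_diagonal]
  rfl

theorem sum_normSq_row (U : Matrix.unitaryGroup ι ℂ) (z : ι) :
    ∑ i, Complex.normSq (U.1 z i) = 1 := by
  have h := congrFun (congrFun (Unitary.coe_mul_star_self U) z) z
  rw [Matrix.mul_apply, Matrix.one_apply_eq] at h
  have h2 := congrArg Complex.re h
  simpa [Complex.mul_conj, Matrix.star_apply] using h2

theorem sum_normSq_col (U : Matrix.unitaryGroup ι ℂ) (i : ι) :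
    ∑ z, Complex.normSq (U.1 z i) = 1 := by
  simpa [Matrix.star_apply] using sum_normSq_row (star U) i

theorem diag_eq_sum_eigenvalues {M : Matrix ι ι ℂ} (hM : M.IsHermitian) (z : ι) :
    (M z z).re = ∑ i, Complex.normSq (hM.eigenvectorUnitary.1 z i) * hM.eigenvalues i := by
  rw [apply_eq_sum_eigenvalues hM, Complex.re_sum]
  refine Finset.sum_congr rfl fun i _ => ?_
  rw [mul_right_comm, ← starRingEnd_apply, Complex.mul_conj, ← Complex.ofReal_mul,
    Complex.ofReal_re]

/-- Each diagonal entry averages the eigenvalues with weights |U z i|², so Jensen applies; these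
weights are doubly stochastic, and summing over z restores every eigenvalue once. -/
theorem le_sum_diag {M : Matrix ι ι ℂ} (hM : M.PosSemidef) :
    spectralEntropy M ≤ ∑ z, Real.negMulLog (M z z).re := by
  have h := hM.isHermitian
  have hz (z : ι) : ∑ i, Complex.normSq (h.eigenvectorUnitary.1 z i) *
      Real.negMulLog (h.eigenvalues i) ≤ Real.negMulLog (M z z).re := by
    rw [diag_eq_sum_eigenvalues h]
    exact Real.concaveOn_negMulLog.le_map_sum (fun _ _ => Complex.normSq_nonneg _)
      (sum_normSq_row _ z) fun i _ => hM.eigenvalues_nonneg i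
  rw [eq_sum_eigenvalues h]
  refine le_trans (le_of_eq ?_) (Finset.sum_le_sum fun z _ => hz z)
  rw [Finset.sum_comm]
  refine Finset.sum_congr rfl fun i _ => ?_
  rw [← Finset.sum_mul, sum_normSq_col, one_mul]

/-- Mixing in an ensemble of unit vectors raises the entropy by at most the Shannon entropy of
the weights. -/
theorem add_ensemble_le {A : Matrix ι ι ℂ} (hA : A.PosSemidef) (p : κ → ℝ) (hp : ∀ j, 0 ≤ p j)
    (v : κ → ι → ℂ) (hv : ∀ j, (vecMulVec (v j) (star (v j))).trace = 1) :
    spectralEntropy (A + ∑ j, (p j : ℂ) • vecMulVec (v j) (star (v j))) ≤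
      spectralEntropy A + ∑ j, Real.negMulLog (p j) := by
  have h := hA.isHermitian
  -- The columns are √λᵢ uᵢ (eigenpairs of A) and √pⱼ vⱼ. Then V Vᴴ is the mixture, while the Gram
  -- matrix Vᴴ V has the same entropy and has the λᵢ and pⱼ on its diagonal.
  let V : Matrix ι (ι ⊕ κ) ℂ := Matrix.of fun z => Sum.elim
    (fun i => ((√(h.eigenvalues i) : ℝ) : ℂ) * h.eigenvectorUnitary.1 z i)
    (fun j => ((√(p j) : ℝ) : ℂ) * v j z)
  have sq {x : ℝ} (hx : 0 ≤ x) : ((√x : ℝ) : ℂ) * ((√x : ℝ) : ℂ) = x := by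
    rw [← Complex.ofReal_mul, Real.mul_self_sqrt hx]
  have hV : V * Vᴴ = A + ∑ j, (p j : ℂ) • vecMulVec (v j) (star (v j)) := by
    ext z w
    rw [Matrix.mul_apply, Fintype.sum_sum_type, Matrix.add_apply, apply_eq_sum_eigenvalues h,
      Matrix.sum_apply]
    congr 1 <;> refine Finset.sum_congr rfl fun i _ => ?_
    · rw [← sq (hA.eigenvalues_nonneg i)]
      simp [V]
      ring
    · rw [← sq (hp i)]
      simp [V, vecMulVec_apply]
      ring
  have hl (i : ι) : ((Vᴴ * V) (Sum.inl i) (Sum.inl i)).re = h.eigenvalues i := by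
    rw [Matrix.mul_apply, Complex.re_sum]
    conv_rhs => rw [← one_mul (h.eigenvalues i), ← sum_normSq_col h.eigenvectorUnitary i,
      Finset.sum_mul]
    refine Finset.sum_congr rfl fun z _ => ?_
    rw [Matrix.conjTranspose_apply, ← starRingEnd_apply, _root_.mul_comm, Complex.mul_conj,
      Complex.ofReal_re]
    simp only [V, Matrix.of_apply, Sum.elim_inl, Complex.normSq_mul, Complex.normSq_ofReal,
      Real.mul_self_sqrt (hA.eigenvalues_nonneg i)]
    exact _root_.mul_comm _ _
  have hr (j : κ) : ((Vᴴ * V) (Sum.inr j) (Sum.inr j)).re = p j := by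
    have hj := congrArg Complex.re (hv j)
    simp only [Matrix.trace, Matrix.diag_apply, vecMulVec_apply, Pi.star_apply, Complex.re_sum,
      Complex.one_re] at hj
    simp only [← starRingEnd_apply, Complex.mul_conj, Complex.ofReal_re] at hj
    rw [Matrix.mul_apply, Complex.re_sum, ← one_mul (p j), ← hj, Finset.sum_mul]
    refine Finset.sum_congr rfl fun z _ => ?_
    rw [Matrix.conjTranspose_apply, ← starRingEnd_apply, _root_.mul_comm, Complex.mul_conj,
      Complex.ofReal_re]
    simp only [V, Matrix.of_apply, Sum.elim_inr, Complex.normSq_mul, Complex.normSq_ofReal,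
      Real.mul_self_sqrt (hp j)]
    exact _root_.mul_comm _ _
  rw [← hV, spectralEntropy.mul_comm]
  refine (le_sum_diag (Matrix.posSemidef_conjTranspose_mul_self V)).trans_eq ?_
  rw [Fintype.sum_sum_type, eq_sum_eigenvalues h]
  simp only [hl, hr]

/-- The difference is a (log (a + b) - log a) + b log (a + b), and log x ≤ x - 1 bounds each term by
b. -/
theorem _root_.Real.negMulLog_le_negMulLog_add {a b : ℝ} (ha : 0 ≤ a) (ha1 : a ≤ 1) (hb : 0 ≤ b)
    (hb1 : b ≤ 1) : Real.negMulLog a ≤ Real.negMulLog (a + b) + 2 * b := by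
  rcases ha.eq_or_lt with rfl | ha
  · have := Real.negMulLog_nonneg hb hb1
    simp only [Real.negMulLog_zero, zero_add]
    linarith
  have hab : 0 < a + b := by linarith
  have h1 : Real.log (a + b) ≤ 1 := by linarith [Real.log_le_sub_one_of_pos hab]
  have h2 : Real.log (a + b) - Real.log a ≤ b / a := by
    rw [← Real.log_div hab.ne' ha.ne']
    refine (Real.log_le_sub_one_of_pos (div_pos hab ha)).trans_eq ?_
    field_simp
    ring
  have h3 : a * (Real.log (a + b) - Real.log a) ≤ b :=
    (mul_le_mul_of_nonneg_left h2 ha.le).trans_eq (mul_div_cancel₀ b ha.ne')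
  have h4 := mul_le_mul_of_nonneg_left h1 hb
  simp only [Real.negMulLog]
  linarith

/-- Adding a positive matrix of small trace lowers the entropy by at most twice that trace. -/
theorem le_add_posSemidef {A B : Matrix ι ι ℂ} (hA : A.PosSemidef) (hB : B.PosSemidef)
    (hA1 : A.trace.re ≤ 1) (hB1 : B.trace.re ≤ 1) :
    spectralEntropy A ≤ spectralEntropy (A + B) + 2 * B.trace.re := by
  have h := (hA.add hB).isHermitian
  -- In an eigenbasis of A + B the diagonal gives the entropy of A + B exactly and that of A from
  -- above, so scalar comparison of diagonal entries suffices.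
  set U := h.eigenvectorUnitary
  have conj_psd {C : Matrix ι ι ℂ} (hC : C.PosSemidef) : (U.1ᴴ * C * U.1).PosSemidef :=
    hC.conjTranspose_mul_mul_same _
  have conj_trace (C : Matrix ι ι ℂ) : ∑ z, ((U.1ᴴ * C * U.1) z z).re = C.trace.re := by
    have : (U.1ᴴ * C * U.1).trace = C.trace := by
      rw [Matrix.trace_mul_comm, ← Matrix.mul_assoc, ← star_eq_conjTranspose,
        Matrix.mem_unitaryGroup_iff.1 U.2, Matrix.one_mul]
    rw [← this, Matrix.trace, Complex.re_sum]
    rfl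
  have nonneg {C : Matrix ι ι ℂ} (hC : C.PosSemidef) (z : ι) : 0 ≤ ((U.1ᴴ * C * U.1) z z).re :=
    (Complex.le_def.1 ((conj_psd hC).diag_nonneg (i := z))).1
  have le_trace {C : Matrix ι ι ℂ} (hC : C.PosSemidef) (z : ι) :
      ((U.1ᴴ * C * U.1) z z).re ≤ C.trace.re := by
    rw [← conj_trace C]
    exact Finset.single_le_sum (f := fun z => ((U.1ᴴ * C * U.1) z z).re)
      (fun z _ => nonneg hC z) (Finset.mem_univ z)
  have diag (z : ι) : h.eigenvalues z =
      ((U.1ᴴ * A * U.1) z z).re + ((U.1ᴴ * B * U.1) z z).re := by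
    have hd := congrFun (congrFun h.conjStarAlgAut_star_eigenvectorUnitary z) z
    rw [Unitary.conjStarAlgAut_star_apply, Matrix.diagonal_apply_eq, star_eq_conjTranspose,
      Matrix.mul_add, Matrix.add_mul, Matrix.add_apply] at hd
    simpa using (congrArg Complex.re hd).symm
  rw [← unitary_conj A U]
  refine (le_sum_diag (conj_psd hA)).trans ?_
  rw [eq_sum_eigenvalues h, ← conj_trace B, Finset.mul_sum, ← Finset.sum_add_distrib]
  refine Finset.sum_le_sum fun z _ => ?_
  rw [diag]
  exact Real.negMulLog_le_negMulLog_add (nonneg hA z) ((le_trace hA z).trans hA1) (nonneg hB z)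
    ((le_trace hB z).trans hB1)

end spectralEntropy

/-- Among nonnegative weights with a given sum, the constant ones have the largest entropy. -/
theorem Real.sum_negMulLog_le {κ : Type*} [Fintype κ] [Nonempty κ] (p : κ → ℝ)
    (hp : ∀ j, 0 ≤ p j) : ∑ j, Real.negMulLog (p j) ≤
      Real.negMulLog (∑ j, p j) + (∑ j, p j) * Real.log (Fintype.card κ) := by
  have hc : (0 : ℝ) < Fintype.card κ := by exact_mod_cast Fintype.card_pos
  have h := Real.concaveOn_negMulLog.le_map_sum (t := Finset.univ)
    (w := fun _ : κ => (Fintype.card κ : ℝ)⁻¹) (p := p) (fun _ _ => by positivity)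
    (by simp) fun j _ => hp j
  simp only [smul_eq_mul, ← Finset.mul_sum, Real.negMulLog_mul] at h
  have h2 := mul_le_mul_of_nonneg_left h hc.le
  have h3 : Real.negMulLog (Fintype.card κ : ℝ)⁻¹ =
      (Fintype.card κ : ℝ)⁻¹ * Real.log (Fintype.card κ) := by
    rw [Real.negMulLog, Real.log_inv]; ring
  rw [h3] at h2
  field_simp at h2
  linarith

/-! ### Continuity of the entropy of encoded states -/

theorem vonNeumannEntropy_mul_log {ι : Type} [Fintype ι] [DecidableEq ι] (ρ : DensityMatrix ι) :
    vonNeumannEntropy ρ * Real.log 2 = spectralEntropy ρ.mat := by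
  have h2 : Real.log 2 ≠ 0 := (Real.log_pos one_lt_two).ne'
  rw [vonNeumannEntropy, spectralEntropy.eq_sum_eigenvalues ρ.posSemidef.isHermitian, neg_mul,
    Finset.sum_mul, ← Finset.sum_neg_distrib]
  refine Finset.sum_congr rfl fun i _ => ?_
  rw [Real.logb, Real.negMulLog]
  field_simp

theorem traceDistance_comm {α : Type} [Fintype α] (a b : PMF α) :
    traceDistance a b = traceDistance b a := by
  simp only [traceDistance, abs_sub_comm]

theorem traceDistance_nonneg {α : Type} [Fintype α] (a b : PMF α) : 0 ≤ traceDistance a b :=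
  mul_nonneg (by norm_num) (Finset.sum_nonneg fun _ _ => abs_nonneg _)

/-- Since a - b sums to zero, its positive part carries half of its ℓ¹ norm. -/
theorem sum_posPart_sub_eq_traceDistance {α : Type} [Fintype α] (a b : PMF α) :
    ∑ j, max ((a j).toReal - (b j).toReal) 0 = traceDistance a b := by
  have h : ∑ j, ((a j).toReal - (b j).toReal) = 0 := by
    rw [Finset.sum_sub_distrib, pmf_sum_toReal, pmf_sum_toReal, sub_self]
  have h2 : ∀ x : ℝ, max x 0 = (1 / 2) * |x| + (1 / 2) * x := fun x => by
    rcases le_total x 0 with hx | hx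
    · rw [max_eq_right hx, abs_of_nonpos hx]; ring
    · rw [max_eq_left hx, abs_of_nonneg hx]; ring
  simp only [h2, Finset.sum_add_distrib, ← Finset.mul_sum, h, mul_zero, add_zero, traceDistance]

theorem spectralEntropy_encodedState_sub_le {k : ℕ} (y : Fin k → Fin 2)
    (p q : PMF (Fin k → Fin 2)) (hpq : traceDistance p q ≤ 1) :
    spectralEntropy (encodedState y p).mat - spectralEntropy (encodedState y q).mat ≤
      2 * traceDistance p q + Real.negMulLog (traceDistance p q) +
        traceDistance p q * (k * Real.log 2) := by
  set a : (Fin k → Fin 2) → ℝ := fun j => max ((q j).toReal - (p j).toReal) 0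
  set b : (Fin k → Fin 2) → ℝ := fun j => max ((p j).toReal - (q j).toReal) 0
  have hb (j) : 0 ≤ b j := le_max_right _ _
  set A := ∑ j, (a j : ℂ) • codeProjector j y
  set B := ∑ j, (b j : ℂ) • codeProjector j y
  have hA : A.PosSemidef := by
    refine Matrix.posSemidef_sum _ fun j _ =>
      (Matrix.posSemidef_vecMulVec_self_star _).smul ?_
    exact_mod_cast le_max_right ((q j).toReal - (p j).toReal) 0
  have hAtr : A.trace.re = traceDistance p q := by
    rw [traceDistance_comm, ← sum_posPart_sub_eq_traceDistance]
    simp [A, a, Matrix.trace_sum, codeProjector_trace]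
  have hAB : (encodedState y p).mat + A = (encodedState y q).mat + B := by
    simp only [encodedState, A, B, ← Finset.sum_add_distrib, ← add_smul, ← Complex.ofReal_add]
    refine Finset.sum_congr rfl fun j _ => ?_
    congr 2
    simp only [a, b]
    rcases le_total (p j).toReal (q j).toReal with h | h
    · rw [max_eq_left (sub_nonneg.2 h), max_eq_right (sub_nonpos.2 h)]; ring
    · rw [max_eq_right (sub_nonpos.2 h), max_eq_left (sub_nonneg.2 h)]; ring
  have h1 := spectralEntropy.le_add_posSemidef (encodedState y p).posSemidef hA
    (by rw [(encodedState y p).trace_eq_one, Complex.one_re]) (hAtr.trans_le hpq)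
  rw [hAB, hAtr] at h1
  have h2 : spectralEntropy ((encodedState y q).mat + B) ≤
      spectralEntropy (encodedState y q).mat + ∑ j, Real.negMulLog (b j) :=
    spectralEntropy.add_ensemble_le (encodedState y q).posSemidef b hb
      (fun j => codeVector j y) fun j => codeProjector_trace j y
  -- The factor k log 2 is the logarithm of the number 2^k of bit strings.
  have h3 := Real.sum_negMulLog_le b hb
  rw [show ∑ j, b j = traceDistance p q from sum_posPart_sub_eq_traceDistance p q,
    Fintype.card_fun, Fintype.card_fin, Fintype.card_fin, Nat.cast_pow, Real.log_pow] at h3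
  push_cast at h3
  linarith

/-- A continuity bound of Fannes type for the entropy of an encoded state. -/
theorem abs_vonNeumannEntropy_encodedState_sub_le {k : ℕ} (y : Fin k → Fin 2)
    (p q : PMF (Fin k → Fin 2)) (hpq : traceDistance p q ≤ 1) :
    |vonNeumannEntropy (encodedState y p) - vonNeumannEntropy (encodedState y q)| ≤
      (2 * traceDistance p q + Real.negMulLog (traceDistance p q)) / Real.log 2 +
        k * traceDistance p q := by
  have hlog : 0 < Real.log 2 := Real.log_pos one_lt_two
  have h1 := spectralEntropy_encodedState_sub_le y p q hpq
  have h2 := spectralEntropy_encodedState_sub_le y q p (traceDistance_comm p q ▸ hpq)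
  rw [traceDistance_comm q p] at h2
  rw [← mul_le_mul_iff_left₀ hlog, ← abs_of_pos hlog, ← abs_mul, abs_of_pos hlog, sub_mul,
    vonNeumannEntropy_mul_log, vonNeumannEntropy_mul_log, add_mul, div_mul_cancel₀ _ hlog.ne']
  exact abs_le.2 ⟨by linarith, by linarith⟩

/-! ### The limit -/

theorem mainTheorem4 (G : BitGenerator) (f : ℕ → ℕ → ℝ) (g : ℕ → ℕ)
    (hf : ∀ k n, 0 < f k n) (hg : ∀ n, 0 < g n)
    (hg_lim : Tendsto g atTop atTop)
    (hfg_lim : Tendsto (fun n => (g n : ℝ) * f (g n) n) atTop (𝓝 0))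
    (i : ℕ → ℕ)
    (hbias : ∀ n k, 1 ≤ k → k ≤ g n → bias (blockLaw G n (i n) k) ≤ f k n)
    (Y : (n : ℕ) → Fin (g n) → Fin 2) :
    Tendsto
      (fun n => |vonNeumannEntropy (encodedState (Y n) (blockLaw G n (i n) (g n))) -
        vonNeumannEntropy (fairState (Y n))|)
      atTop (𝓝 0) := by
  set ε : ℕ → ℝ := fun n => bias (blockLaw G n (i n) (g n))
  have hε0 (n) : 0 ≤ ε n := traceDistance_nonneg _ _
  have hg1 (n) : (1 : ℝ) ≤ g n := by exact_mod_cast hg n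
  have hgε : Tendsto (fun n => (g n : ℝ) * ε n) atTop (𝓝 0) :=
    squeeze_zero (fun n => mul_nonneg (Nat.cast_nonneg _) (hε0 n))
      (fun n => mul_le_mul_of_nonneg_left (hbias n (g n) (hg n) le_rfl) (Nat.cast_nonneg _))
      hfg_lim
  -- As g ≥ 1, the bias itself tends to 0, so it is eventually at most 1, as the continuity bound
  -- requires.
  have hε : Tendsto ε atTop (𝓝 0) :=
    squeeze_zero hε0 (fun n => le_mul_of_one_le_left (hε0 n) (hg1 n)) hgε
  have hη : Tendsto (fun n => Real.negMulLog (ε n)) atTop (𝓝 0) := by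
    simpa [Function.comp_def] using (Real.continuous_negMulLog.tendsto 0).comp hε
  have hlim : Tendsto (fun n => (2 * ε n + Real.negMulLog (ε n)) / Real.log 2 + g n * ε n)
      atTop (𝓝 0) := by
    simpa using (((hε.const_mul 2).add hη).div_const (Real.log 2)).add hgε
  refine squeeze_zero' (Eventually.of_forall fun n => abs_nonneg _) ?_ hlim
  filter_upwards [hε.eventually_le_const one_pos] with n hn
  exact abs_vonNeumannEntropy_encodedState_sub_le (Y n) _ _ hn
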